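/- **Proposition.** Let $k$ be a field, let $q \in k$ be arbitrary, and let $A_q := k\langle x,y\rangle/(x^2,\ xy+q\,yx,\ y^2)$. For a $k$-algebra $A$ and $n \ge 0$ let $HH_n(A)$ be the $n$-th homology of the Hochschild complex $\cdots \to A^{\otimes_k (n+1)} \xrightarrow{b_n} A^{\otimes_k n} \to \cdots \to A \to 0$ (with $A^{\otimes_k (n+1)}$ in degree $n$), $$b_n(a_0\otimes\cdots\otimes a_n)=\sum_{i=0}^{n-1}(-1)^i\,a_0\otimes\cdots\otimes a_ia_{i+1}\otimes\cdots\otimes a_n+(-1)^n\,a_na_0\otimes a_1\otimes\cdots\otimes a_{n-1},$$ let $hh_n(A):=\dim_k HH_n(A)$, and let $\operatorname{hh.dim} A:=\inf\{n\in\mathbb N_0 : hh_i(A)=0 \text{ for all } i>n\}\in\mathbb N_0\cup\{\infty\}$ be the Hochschild homology dimension of $A$ (with $\inf\emptyset=\infty$). Let $\operatorname{gl.dim} A$ be the global dimension of $A$, that is, the supremum of the projective dimensions of the left $A$-modules. Then $$\operatorname{hh.dim} A_q=\infty=\operatorname{gl.dim} A_q .$$ In fact $hh_n(A_q)\ge 2$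 for every $n\ge 0$. -/

import Mathlib

namespace Hochschild

open scoped TensorProduct

universe u

section Faces

variable {A : Type u} [Ring A]

/-- The `i`-th face of a tuple `(a_0, …, a_{n+1})`. For `i ≤ n` it is
`(a_0, …, a_i * a_{i+1}, …, a_{n+1})`, and for `i = n + 1` it is
`(a_{n+1} * a_0, a_1, …, a_n)`. -/
def faceTuple {n : ℕ} (i : Fin (n + 2)) (a : Fin (n + 2) → A) : Fin (n + 1) → A := fun j =>
  if (i : ℕ) ≤ n then
    if (j : ℕ) < i then a j.castSucc
    else if (j : ℕ) = i then a j.castSucc * a j.succ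
    else a j.succ
  else
    if (j : ℕ) = 0 then a (Fin.last (n + 1)) * a 0
    else a j.castSucc

/-- The simplicial identity for the faces of a tuple. -/
theorem faceTuple_faceTuple {n : ℕ} (a : Fin (n + 3) → A) (i : Fin (n + 3)) (j : Fin (n + 2))
    (h : (i : ℕ) ≤ j) :
    faceTuple j (faceTuple i a) =
      faceTuple (Fin.castLT i (lt_of_le_of_lt h j.is_lt)) (faceTuple j.succ a) := by
  obtain ⟨i, hi⟩ := i
  obtain ⟨j, hj⟩ := j
  funext ⟨l, hl⟩
  have e0 : (0 : Fin (n + 3)) = ⟨0, by omega⟩ := rfl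
  have e1 : (0 : Fin (n + 2)) = ⟨0, by omega⟩ := rfl
  simp only [faceTuple, e0, e1, Fin.last, Fin.castSucc_mk, Fin.succ_mk, Fin.castLT_mk] at h ⊢
  rcases Nat.lt_or_ge n j with hj' | hj' <;> rcases Nat.lt_or_ge (n + 1) i with hi' | hi' <;>
    rcases lt_trichotomy l i with h1 | h1 | h1 <;>
    rcases lt_trichotomy l j with h2 | h2 | h2 <;>
    rcases Nat.eq_zero_or_pos l with h3 | h3 <;> first
      | omega
      | grind [mul_assoc]

/-- Changing one entry of a tuple changes its face in one entry, in a linear way. -/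
theorem faceTuple_update (k : Type u) [Field k] [Algebra k A] {n : ℕ} (i : Fin (n + 2))
    (a : Fin (n + 2) → A) (c : Fin (n + 2)) :
    ∃ (j : Fin (n + 1)) (L : A →ₗ[k] A),
      ∀ x, faceTuple i (Function.update a c x) = Function.update (faceTuple i a) j (L x) := by
  obtain ⟨i, hi⟩ := i
  obtain ⟨c, hc⟩ := c
  have e0 : (0 : Fin (n + 2)) = ⟨0, by omega⟩ := rfl
  by_cases hin : i ≤ n
  · rcases lt_trichotomy c i with h | h | h
    · refine ⟨⟨c, by omega⟩, LinearMap.id, fun x => funext fun ⟨l, hl⟩ => ?_⟩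
      simp only [faceTuple, Function.update_apply, Fin.ext_iff, Fin.castSucc_mk, Fin.succ_mk,
        LinearMap.id_apply]
      grind
    · refine ⟨⟨i, by omega⟩, LinearMap.mulRight k (a ⟨i + 1, by omega⟩),
        fun x => funext fun ⟨l, hl⟩ => ?_⟩
      simp only [faceTuple, Function.update_apply, Fin.ext_iff, Fin.castSucc_mk, Fin.succ_mk,
        LinearMap.mulRight_apply]
      grind
    · by_cases h' : c = i + 1
      · refine ⟨⟨i, by omega⟩, LinearMap.mulLeft k (a ⟨i, by omega⟩),
          fun x => funext fun ⟨l, hl⟩ => ?_⟩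
        simp only [faceTuple, Function.update_apply, Fin.ext_iff, Fin.castSucc_mk, Fin.succ_mk,
          LinearMap.mulLeft_apply]
        grind
      · refine ⟨⟨c - 1, by omega⟩, LinearMap.id, fun x => funext fun ⟨l, hl⟩ => ?_⟩
        simp only [faceTuple, Function.update_apply, Fin.ext_iff, Fin.castSucc_mk, Fin.succ_mk,
          LinearMap.id_apply]
        grind
  · by_cases h0 : c = 0
    · refine ⟨⟨0, by omega⟩, LinearMap.mulLeft k (a (Fin.last (n + 1))),
        fun x => funext fun ⟨l, hl⟩ => ?_⟩
      simp only [faceTuple, Function.update_apply, Fin.ext_iff, Fin.castSucc_mk, Fin.succ_mk,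
        LinearMap.mulLeft_apply, Fin.val_last, e0]
      grind
    · by_cases h1 : c = n + 1
      · refine ⟨⟨0, by omega⟩, LinearMap.mulRight k (a 0), fun x => funext fun ⟨l, hl⟩ => ?_⟩
        simp only [faceTuple, Function.update_apply, Fin.ext_iff, Fin.castSucc_mk, Fin.succ_mk,
          LinearMap.mulRight_apply, Fin.val_last, e0]
        grind
      · refine ⟨⟨c, by omega⟩, LinearMap.id, fun x => funext fun ⟨l, hl⟩ => ?_⟩
        simp only [faceTuple, Function.update_apply, Fin.ext_iff, Fin.castSucc_mk, Fin.succ_mk,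
          LinearMap.id_apply, Fin.val_last, e0]
        grind

end Faces

section Complex

variable (k A : Type u) [Field k] [Ring A] [Algebra k A]

/-- The `i`-th face map `A^{⊗ (n+2)} → A^{⊗ (n+1)}` of the cyclic bar complex,
`a_0 ⊗ ⋯ ⊗ a_{n+1} ↦ a_0 ⊗ ⋯ ⊗ a_i a_{i+1} ⊗ ⋯ ⊗ a_{n+1}` for `i ≤ n` and
`a_0 ⊗ ⋯ ⊗ a_{n+1} ↦ a_{n+1} a_0 ⊗ a_1 ⊗ ⋯ ⊗ a_n` for `i = n + 1`. -/
noncomputable def face {n : ℕ} (i : Fin (n + 2)) :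
    (⨂[k] _ : Fin (n + 2), A) →ₗ[k] (⨂[k] _ : Fin (n + 1), A) :=
  PiTensorProduct.lift <| MultilinearMap.mk'
    (fun a : Fin (n + 2) → A => PiTensorProduct.tprod k (faceTuple i a))
    (fun a c x y => by
      obtain ⟨j, L, h⟩ := faceTuple_update k i a c
      simp only [h, map_add, MultilinearMap.map_update_add])
    (fun a c r x => by
      obtain ⟨j, L, h⟩ := faceTuple_update k i a c
      simp only [h, map_smul, MultilinearMap.map_update_smul])

theorem face_tprod {n : ℕ} (i : Fin (n + 2)) (a : Fin (n + 2) → A) :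
    face k A i (PiTensorProduct.tprod k a) = PiTensorProduct.tprod k (faceTuple i a) := by
  simp [face]

theorem face_comp_face {n : ℕ} (i : Fin (n + 3)) (j : Fin (n + 2)) (h : (i : ℕ) ≤ j) :
    face k A j ∘ₗ face k A i =
      face k A (Fin.castLT i (lt_of_le_of_lt h j.is_lt)) ∘ₗ face k A j.succ := by
  refine PiTensorProduct.ext (MultilinearMap.ext fun a => ?_)
  simp only [LinearMap.compMultilinearMap_apply, LinearMap.comp_apply, face_tprod,
    faceTuple_faceTuple a i j h]

/-- The Hochschild differential `b_{n+1} : A^{⊗ (n+2)} → A^{⊗ (n+1)}`, the alternating sum of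
the face maps. -/
noncomputable def differential (n : ℕ) :
    (⨂[k] _ : Fin (n + 2), A) →ₗ[k] (⨂[k] _ : Fin (n + 1), A) :=
  ∑ i : Fin (n + 2), (-1 : k) ^ (i : ℕ) • face k A i

theorem differential_comp_differential (n : ℕ) :
    differential k A n ∘ₗ differential k A (n + 1) = 0 := by
  have key : differential k A n ∘ₗ differential k A (n + 1) =
      ∑ p : Fin (n + 2) × Fin (n + 3),
        ((-1 : k) ^ (p.1 : ℕ) * (-1 : k) ^ (p.2 : ℕ)) • (face k A p.1 ∘ₗ face k A p.2) := by
    rw [Fintype.sum_prod_type]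
    refine LinearMap.ext fun x => ?_
    simp only [differential, LinearMap.comp_apply, LinearMap.sum_apply, LinearMap.smul_apply,
      map_sum, map_smul, smul_smul, Finset.smul_sum]
    rw [Finset.sum_comm]
    simp only [mul_comm]
  rw [key]
  let S : Finset (Fin (n + 2) × Fin (n + 3)) := {p | (p.2 : ℕ) ≤ (p.1 : ℕ)}
  rw [← Finset.sum_add_sum_compl S, ← eq_neg_iff_add_eq_zero, ← Finset.sum_neg_distrib]
  have hS : ∀ p, p ∈ S ↔ (p.2 : ℕ) ≤ (p.1 : ℕ) := fun p => by simp [S]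
  refine Finset.sum_bij
    (fun p hp => (Fin.castLT p.2 (lt_of_le_of_lt ((hS p).1 hp) p.1.is_lt), p.1.succ)) ?_ ?_ ?_ ?_
  · intro p hp
    have := (hS p).1 hp
    simp only [Finset.mem_compl, hS, Fin.val_succ, Fin.val_castLT]
    omega
  · rintro ⟨i, j⟩ hp ⟨i', j'⟩ hp' h
    simp only [Prod.mk.injEq, Fin.ext_iff, Fin.val_succ, Fin.val_castLT] at h ⊢
    omega
  · rintro ⟨i, j⟩ hp
    simp only [Finset.mem_compl, hS] at hp
    refine ⟨(⟨j - 1, by omega⟩, i.castSucc), ?_, ?_⟩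
    · refine (hS _).2 ?_
      change (i : ℕ) ≤ (j : ℕ) - 1
      omega
    · simp only [Prod.mk.injEq, Fin.ext_iff, Fin.val_succ, Fin.val_castLT, Fin.val_castSucc]
      exact ⟨trivial, by omega⟩
  · rintro ⟨i, j⟩ hp
    have hij := (hS _).1 hp
    dsimp only at hij ⊢
    have hc : (-1 : k) ^ (i : ℕ) * (-1 : k) ^ (j : ℕ) +
        (-1 : k) ^ (j : ℕ) * (-1 : k) ^ ((i : ℕ) + 1) = 0 := by ring
    simp only [Fin.val_succ, Fin.val_castLT]
    rw [face_comp_face k A j i hij]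
    refine eq_neg_of_add_eq_zero_left ?_
    rw [← add_smul, hc, zero_smul]

/-- The Hochschild complex (cyclic bar complex) of the `k`-algebra `A`, with `A^{⊗ (n+1)}` in
degree `n`. -/
noncomputable def hochschildComplex : ChainComplex (ModuleCat.{u} k) ℕ :=
  ChainComplex.of (fun n => ModuleCat.of k (⨂[k] _ : Fin (n + 1), A))
    (fun n => ModuleCat.ofHom (differential k A n))
    (fun n => by
      rw [← ModuleCat.ofHom_comp, differential_comp_differential]
      rfl)

/-- The Hochschild homology group `HH_n(A)`, a `k`-vector space. -/
noncomputable def HH (n : ℕ) : ModuleCat.{u} k := (hochschildComplex k A).homology n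

/-- `hh_n(A)`, the dimension over `k` of `HH_n(A)`. -/
noncomputable def hh (n : ℕ) : Cardinal.{u} := Module.rank k (HH k A n)

/-- The Hochschild homology dimension: the infimum in `ℕ ∪ {∞}` of all natural numbers `n` such
that `hh_i(A) = 0` for every `i > n`. -/
noncomputable def hhDim : ℕ∞ :=
  sInf {d : ℕ∞ | ∃ n : ℕ, d = n ∧ ∀ i : ℕ, n < i → hh k A i = 0}

end Complex

/-- The (left) global dimension of a ring: the supremum of the projective dimensions of all its
left modules. -/
noncomputable def globalDim (R : Type u) [Ring R] : WithBot ℕ∞ :=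
  ⨆ M : ModuleCat.{u} R, CategoryTheory.projectiveDimension M

section Algebra

variable {k : Type u} [Field k]

/-- The defining relations `x² = 0`, `xy + q yx = 0`, `y² = 0`, where `x` and `y` are the two
generators of the free algebra `k⟨x, y⟩`. -/
inductive Rel (q : k) : FreeAlgebra k (Fin 2) → FreeAlgebra k (Fin 2) → Prop
  | xx : Rel q (FreeAlgebra.ι k 0 * FreeAlgebra.ι k 0) 0
  | xy : Rel q (FreeAlgebra.ι k 0 * FreeAlgebra.ι k 1 +
      q • (FreeAlgebra.ι k 1 * FreeAlgebra.ι k 0)) 0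
  | yy : Rel q (FreeAlgebra.ι k 1 * FreeAlgebra.ι k 1) 0

/-- The algebra `A_q = k⟨x, y⟩ / (x², xy + q yx, y²)`. -/
abbrev Aq (q : k) : Type u := RingQuot (Rel q)

end Algebra

end Hochschild

/-! Each generator `x_i` of `A_q` squares to zero, and some algebra map `A_q → k[ε]` sends it to `ε`
and the other generator to `0`. Writing this map as `e_i + d_i ε` gives an augmentation `e_i` and a
derivation `d_i` over it, with `d_i (x_j) = δ_ij`. In even degrees `x_i ⊗ ⋯ ⊗ x_i` is a cycle and
`d_i ⊗ ⋯ ⊗ d_i` a cocycle; in odd degrees `1 ⊗ x_i ⊗ ⋯ ⊗ x_i` and `e_i ⊗ d_i ⊗ ⋯ ⊗ d_i` are. Their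
pairing is the identity matrix, so `hh_n ≥ 2` in every degree (`le_hh_of_algHom_dualNumber`), for
every `q` and every characteristic.

For the global dimension, the left annihilator of `x` is `A_q x`, so this module is its own syzygy
and would be projective if its projective dimension were finite. A splitting of `A_q → A_q x` yields
`e` with `e x = x` and `x e = 0`, which is impossible after mapping to the commutative ring `k[ε]`.
-/

namespace Hochschild

open CategoryTheory
open scoped TensorProduct DualNumber

universe u

/-! ### Infinite global dimension from a module that is its own syzygy. -/

section GlobalDimension

variable {R : Type u} [Ring R]

/-- If the left annihilator of `x` is the left ideal `Rx`, then finiteness of the projective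
dimension of `Rx` forces `Rx` to be projective. -/
theorem projective_span_of_hasProjectiveDimensionLT {x : R}
    (hx : ∀ a : R, a * x = 0 ↔ a ∈ R ∙ x) (n : ℕ)
    (h : HasProjectiveDimensionLT (ModuleCat.of R (R ∙ x)) (n + 1)) :
    Projective (ModuleCat.of R (R ∙ x)) := by
  induction n with
  | zero => exact projective_iff_hasProjectiveDimensionLT_one.2 h
  | succ n ih =>
    let f : R →ₗ[R] (R ∙ x) := (LinearMap.toSpanSingleton R R x).codRestrict (R ∙ x)
      fun a => Submodule.smul_mem _ a (Submodule.mem_span_singleton_self x)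
    have hf : Function.Surjective f := by
      rintro ⟨y, hy⟩
      obtain ⟨a, rfl⟩ := Submodule.mem_span_singleton.1 hy
      exact ⟨a, rfl⟩
    have hker : LinearMap.ker f = R ∙ x := by
      ext a
      rw [← hx a, LinearMap.mem_ker, Subtype.ext_iff]
      rfl
    have hP : Projective (ModuleCat.of R R) :=
      (IsProjective.iff_projective R).1 inferInstance
    -- Dimension shift along `0 → ker f → R → Rx → 0`: the bound drops by one while the module stays
    -- `Rx`.
    have h1 : HasProjectiveDimensionLT (ModuleCat.of R (LinearMap.ker f)) (n + 1) :=
      ((LinearMap.shortExact_shortComplexKer hf).hasProjectiveDimensionLT_X₃_iff n hP).1 h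
    rw [hker] at h1
    exact ih h1

theorem globalDim_eq_top_of_not_projective {x : R} (hx : ∀ a : R, a * x = 0 ↔ a ∈ R ∙ x)
    (hP : ¬ Projective (ModuleCat.of R (R ∙ x))) : globalDim R = ⊤ := by
  refine top_unique (le_trans ?_
    (le_iSup (fun M : ModuleCat.{u} R => projectiveDimension M) (ModuleCat.of R (R ∙ x))))
  by_contra h
  obtain ⟨n, hn⟩ := (projectiveDimension_ne_top_iff _).1 (fun e => h e.ge)
  exact hP (projective_span_of_hasProjectiveDimensionLT hx n hn)

/-- `e` is the image of `x` under a linear section `s` of `R → Rx`, so `x e = s (x x) = 0`. -/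
theorem exists_mul_eq_of_projective_span {x : R} (hP : Projective (ModuleCat.of R (R ∙ x)))
    (hxx : x * x = 0) : ∃ e : R, e * x = x ∧ x * e = 0 := by
  have := (IsProjective.iff_projective (R := R) (R ∙ x)).2 hP
  let f : R →ₗ[R] (R ∙ x) := (LinearMap.toSpanSingleton R R x).codRestrict (R ∙ x)
    fun a => Submodule.smul_mem _ a (Submodule.mem_span_singleton_self x)
  have hf : Function.Surjective f := by
    rintro ⟨y, hy⟩
    obtain ⟨a, rfl⟩ := Submodule.mem_span_singleton.1 hy
    exact ⟨a, rfl⟩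
  obtain ⟨s, hs⟩ := Module.projective_lifting_property f LinearMap.id hf
  let x' : (R ∙ x) := ⟨x, Submodule.mem_span_singleton_self x⟩
  have hx' : x • x' = 0 := Subtype.ext hxx
  refine ⟨s x', congrArg Subtype.val (LinearMap.congr_fun hs x'), ?_⟩
  rw [← smul_eq_mul, ← map_smul, hx', map_zero]

end GlobalDimension

/-! ### Structure of `A_q` and its maps to dual numbers. -/

section Generators

variable {k : Type u} [Field k] (q : k)

/-- The generators of `A_q`. -/
noncomputable def gen (i : Fin 2) : Aq q := RingQuot.mkAlgHom k (Rel q) (FreeAlgebra.ι k i)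

theorem gen_zero_mul_gen_zero : gen q 0 * gen q 0 = 0 := by
  simpa [gen] using RingQuot.mkAlgHom_rel k (Rel.xx (q := q))

theorem gen_one_mul_gen_one : gen q 1 * gen q 1 = 0 := by
  simpa [gen] using RingQuot.mkAlgHom_rel k (Rel.yy (q := q))

theorem gen_zero_mul_gen_one : gen q 0 * gen q 1 = (-q) • (gen q 1 * gen q 0) := by
  refine (eq_neg_of_add_eq_zero_left ?_).trans (neg_smul q _).symm
  simpa [gen] using RingQuot.mkAlgHom_rel k (Rel.xy (q := q))

variable {q} in
theorem exists_algHom {B : Type*} [Ring B] [Algebra k B] (b : Fin 2 → B)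
    (hxx : b 0 * b 0 = 0) (hxy : b 0 * b 1 + q • (b 1 * b 0) = 0) (hyy : b 1 * b 1 = 0) :
    ∃ f : Aq q →ₐ[k] B, ∀ i, f (gen q i) = b i := by
  refine ⟨RingQuot.liftAlgHom k ⟨FreeAlgebra.lift k b, ?_⟩, fun i => ?_⟩
  · rintro _ _ (_ | _ | _) <;> simpa
  · simp [gen]

/-- The span contains `1` and is stable under left multiplication by the generators, hence by all of
`A_q`. -/
theorem span_eq_top :
    Submodule.span k {1, gen q 0, gen q 1, gen q 1 * gen q 0} = ⊤ := by
  set S := Submodule.span k {1, gen q 0, gen q 1, gen q 1 * gen q 0} with hS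
  have h1 : (1 : Aq q) ∈ S := Submodule.subset_span (by simp)
  have h2 : gen q 0 ∈ S := Submodule.subset_span (by simp)
  have h3 : gen q 1 ∈ S := Submodule.subset_span (by simp)
  have h4 : gen q 1 * gen q 0 ∈ S := Submodule.subset_span (by simp)
  have hgen : ∀ i, ∀ b ∈ S, gen q i * b ∈ S := by
    intro i b hb
    induction hb using Submodule.span_induction with
    | zero => simp
    | add b c _ _ hb hc => rw [mul_add]; exact S.add_mem hb hc
    | smul r b _ hb => rw [mul_smul_comm]; exact S.smul_mem r hb
    | mem b hb =>
      rcases hb with rfl | rfl | rfl | rfl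
      · fin_cases i <;> simpa
      · fin_cases i
        · simp [gen_zero_mul_gen_zero]
        · exact h4
      · fin_cases i
        · exact (gen_zero_mul_gen_one q).symm ▸ S.smul_mem (-q) h4
        · simp [gen_one_mul_gen_one]
      · fin_cases i
        · simp only [Fin.zero_eta]
          rw [← mul_assoc, gen_zero_mul_gen_one, smul_mul_assoc, mul_assoc,
            gen_zero_mul_gen_zero, mul_zero, smul_zero]
          exact S.zero_mem
        · simp [← mul_assoc, gen_one_mul_gen_one]
  have key : ∀ a : FreeAlgebra k (Fin 2), ∀ b ∈ S, RingQuot.mkAlgHom k (Rel q) a * b ∈ S := by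
    intro a
    induction a using FreeAlgebra.induction with
    | grade0 r =>
      intro b hb
      rw [AlgHom.commutes, ← Algebra.smul_def]
      exact S.smul_mem r hb
    | grade1 i => exact hgen i
    | mul a a' ha ha' =>
      intro b hb
      rw [map_mul, mul_assoc]
      exact ha _ (ha' b hb)
    | add a a' ha ha' =>
      intro b hb
      rw [map_add, add_mul]
      exact S.add_mem (ha b hb) (ha' b hb)
  refine Submodule.eq_top_iff'.2 fun a => ?_
  obtain ⟨a, rfl⟩ := RingQuot.mkAlgHom_surjective k (Rel q) a
  simpa using key a 1 h1

/-- The left regular representation in the basis `1, x, y, yx`. -/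
theorem exists_matrix_rep : ∃ f : Aq q →ₐ[k] Matrix (Fin 4) (Fin 4) k,
    f (gen q 0) = !![0, 0, 0, 0; 1, 0, 0, 0; 0, 0, 0, 0; 0, 0, -q, 0] ∧
    f (gen q 1) = !![0, 0, 0, 0; 0, 0, 0, 0; 1, 0, 0, 0; 0, 1, 0, 0] := by
  obtain ⟨f, hf⟩ := exists_algHom (q := q)
    ![!![0, 0, 0, 0; 1, 0, 0, 0; 0, 0, 0, 0; 0, 0, -q, 0],
      !![0, 0, 0, 0; 0, 0, 0, 0; 1, 0, 0, 0; 0, 1, 0, 0]]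
    (by ext i j; fin_cases i <;> fin_cases j <;> simp [Matrix.mul_apply, Fin.sum_univ_four])
    (by ext i j; fin_cases i <;> fin_cases j <;> simp)
    (by ext i j; fin_cases i <;> fin_cases j <;> simp [Matrix.mul_apply, Fin.sum_univ_four])
  exact ⟨f, hf 0, hf 1⟩

theorem mul_gen_zero_eq_zero_iff (a : Aq q) : a * gen q 0 = 0 ↔ a ∈ Aq q ∙ gen q 0 := by
  rw [Submodule.mem_span_singleton]
  constructor
  · intro ha
    have hmem : a ∈ Submodule.span k {1, gen q 0, gen q 1, gen q 1 * gen q 0} :=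
      span_eq_top q ▸ Submodule.mem_top
    simp only [Submodule.mem_span_insert, Submodule.mem_span_singleton] at hmem
    obtain ⟨r, _, ⟨s, _, ⟨t, _, ⟨u, rfl⟩, rfl⟩, rfl⟩, rfl⟩ := hmem
    obtain ⟨f, hx, hy⟩ := exists_matrix_rep q
    have ha' := congrArg f ha
    simp only [add_mul, smul_mul_assoc, mul_assoc, gen_zero_mul_gen_zero, one_mul, mul_zero,
      smul_zero, add_zero, zero_add, map_add, map_smul, map_mul, map_zero, hx, hy] at ha'
    -- Here `a x = r x + t yx`; column 0 of its matrix is its coordinate vector, with `x` in row 1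
    -- and `yx` in row 3.
    have hr : r = 0 := by
      simpa using congrFun (congrFun ha' 1) 0
    have ht : t = 0 := by
      simpa [Matrix.mul_apply, Fin.sum_univ_four] using congrFun (congrFun ha' 3) 0
    refine ⟨s • 1 + u • gen q 1, ?_⟩
    simp [hr, ht, add_mul]
  · rintro ⟨b, rfl⟩
    rw [smul_eq_mul, mul_assoc, gen_zero_mul_gen_zero, mul_zero]

/-- For each generator there is an algebra map to the dual numbers that sends this generator to
`ε` and the other one to `0`. -/
theorem exists_algHom_dualNumber (i : Fin 2) :
    ∃ f : Aq q →ₐ[k] k[ε], ∀ j, f (gen q j) = if j = i then DualNumber.eps else 0 := by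
  refine exists_algHom (fun j => if j = i then DualNumber.eps else 0) ?_ ?_ ?_ <;>
    fin_cases i <;> simp

theorem globalDim_Aq : globalDim (Aq q) = ⊤ := by
  refine globalDim_eq_top_of_not_projective (mul_gen_zero_eq_zero_iff q) fun hP => ?_
  obtain ⟨e, he, he'⟩ := exists_mul_eq_of_projective_span hP (gen_zero_mul_gen_zero q)
  obtain ⟨f, hf⟩ := exists_algHom_dualNumber q 0
  have h1 : f e * DualNumber.eps = DualNumber.eps := by simpa [hf] using congrArg f he
  have h2 : DualNumber.eps * f e = 0 := by simpa [hf] using congrArg f he'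
  -- Commutativity of `k[ε]` turns the two relations into `ε = 0`.
  rw [(DualNumber.commute_eps_left (f e)).eq, h1] at h2
  simpa using congrArg TrivSqZeroExt.snd h2

end Generators

theorem sum_neg_one_pow_mul_add_succ {R : Type*} [CommRing R] (F : ℕ → R) (n : ℕ) :
    ∑ i ∈ Finset.range n, (-1) ^ i * (F i + F (i + 1)) = F 0 - (-1) ^ n * F n := by
  induction n with
  | zero => simp
  | succ n ih => rw [Finset.sum_range_succ, ih]; ring

/-! ### Bounding `hh_n` below by a pairing. -/

section Rank

variable (k A : Type u) [Field k] [Ring A] [Algebra k A]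

theorem hochschildComplex_d (n : ℕ) :
    (hochschildComplex k A).d (n + 1) n = ModuleCat.ofHom (differential k A n) := by
  simp [hochschildComplex, ChainComplex.of, ChainComplex.of_d]

theorem hochschildComplex_d_apply_eq_zero {n : ℕ} (z : ⨂[k] _ : Fin (n + 2), A)
    (hz : differential k A n z = 0) (l : ℕ) :
    ((hochschildComplex k A).d (n + 1) l).hom z = 0 := by
  by_cases h : l = n
  · subst h
    rw [hochschildComplex_d]
    exact hz
  · rw [(hochschildComplex k A).shape _ _ (by simpa using h)]
    rfl

/-- Cycles and cocycles with a nondegenerate pairing bound `hh_n` from below. -/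
theorem le_hh_of_pairing (n m : ℕ)
    (z : Fin m → ⨂[k] _ : Fin (n + 1), A) (φ : Fin m → (⨂[k] _ : Fin (n + 1), A) →ₗ[k] k)
    (hz : ∀ i l, ((hochschildComplex k A).d n l).hom (z i) = 0)
    (hφ : ∀ i, φ i ∘ₗ differential k A n = 0)
    (hφz : ∀ i j, φ i (z j) = if i = j then 1 else 0) :
    (m : Cardinal.{u}) ≤ hh k A n := by
  let K := hochschildComplex k A
  let V : ModuleCat.{u} k := ModuleCat.of k (Fin m → k)
  let zf : V ⟶ K.X n := ModuleCat.ofHom (Fintype.linearCombination k z)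
  let φf : K.X n ⟶ V := ModuleCat.ofHom (LinearMap.pi φ)
  have h1 : zf ≫ K.d n ((ComplexShape.down ℕ).next n) = 0 := by
    refine ModuleCat.hom_ext (LinearMap.ext fun v => ?_)
    change (K.d n _).hom (Fintype.linearCombination k z v) = 0
    rw [Fintype.linearCombination_apply]
    refine (map_sum (K.d n _).hom _ _).trans (Finset.sum_eq_zero fun i _ => ?_)
    refine (map_smul (K.d n _).hom _ _).trans ?_
    rw [hz i, smul_zero]
  have h2 : K.d (n + 1) n ≫ φf = 0 := by
    rw [show K.d (n + 1) n = _ from hochschildComplex_d k A n]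
    refine ModuleCat.hom_ext (LinearMap.ext fun v => funext fun i => ?_)
    exact LinearMap.congr_fun (hφ i) v
  have h3 : zf ≫ φf = 𝟙 V := by
    refine ModuleCat.hom_ext (LinearMap.ext fun v => funext fun i => ?_)
    change φ i (Fintype.linearCombination k z v) = v i
    simp [Fintype.linearCombination_apply, hφz]
  let g : V ⟶ K.homology n := K.liftCycles zf _ rfl h1 ≫ K.homologyπ n
  let h : K.homology n ⟶ V := K.homologyι n ≫ K.descOpcycles φf (n + 1) (by simp) h2
  -- The identity of `k^m` factors through homology, so `k^m` embeds in it.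
  have hgh : g ≫ h = 𝟙 V := by
    simp only [g, h, Category.assoc, HomologicalComplex.homology_π_ι_assoc]
    rw [K.p_descOpcycles, K.liftCycles_i_assoc, h3]
  have hinj : Function.Injective g.hom :=
    Function.LeftInverse.injective (g := h.hom)
      fun v => LinearMap.congr_fun (congrArg ModuleCat.Hom.hom hgh) v
  have := LinearMap.rank_le_of_injective g.hom hinj
  rwa [rank_fin_fun] at this

end Rank

/-! ### Products of derivations on faces. -/

section Faces

variable {k A : Type*} [Field k] [Ring A]

/-- The product of `e (a_j)` and of all the `d (a_i)` with `i ≠ j`. -/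
def replacedProd (e d : A → k) {n : ℕ} (a : Fin (n + 1) → A) (j : Fin (n + 1)) : k :=
  e (a j) * ∏ l : Fin n, d (a (j.succAbove l))

/-- The Leibniz rule on the merged entry yields two neighbouring terms, so the alternating sum over
these faces telescopes. -/
theorem prod_faceTuple_castSucc {e d : A → k} (hd : ∀ a b, d (a * b) = e a * d b + d a * e b)
    {n : ℕ} (a : Fin (n + 2) → A) (i : Fin (n + 1)) :
    ∏ j, d (faceTuple i.castSucc a j) =
      replacedProd e d a i.castSucc + replacedProd e d a i.succ := by
  rw [replacedProd, replacedProd, Fin.prod_univ_succAbove _ i, Fin.prod_univ_succAbove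
    (fun l => d (a (i.castSucc.succAbove l))) i, Fin.prod_univ_succAbove
    (fun l => d (a (i.succ.succAbove l))) i]
  have h0 : faceTuple i.castSucc a i = a i.castSucc * a i.succ := by
    have := i.is_lt
    simp [faceTuple, Nat.lt_succ_iff.1 this]
  have h1 : ∀ l, a (i.castSucc.succAbove (i.succAbove l)) =
      faceTuple i.castSucc a (i.succAbove l) := by
    intro l
    have := i.is_lt
    simp only [faceTuple, Fin.succAbove, Fin.lt_def, Fin.val_castSucc]
    grind
  have h2 : ∀ l, a (i.succ.succAbove (i.succAbove l)) =
      faceTuple i.castSucc a (i.succAbove l) := by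
    intro l
    have := i.is_lt
    simp only [faceTuple, Fin.succAbove, Fin.lt_def, Fin.val_castSucc, Fin.val_succ]
    grind
  simp only [h0, h1, h2, hd, Fin.succAbove_castSucc_self, Fin.succAbove_succ_self]
  ring

theorem faceTuple_last {n : ℕ} (a : Fin (n + 2) → A) :
    faceTuple (Fin.last (n + 1)) a =
      Fin.cons (a (Fin.last (n + 1)) * a 0) (fun j : Fin n => a j.succ.castSucc) := by
  funext j
  cases j using Fin.cases <;> simp [faceTuple]

theorem faceTuple_zero {n : ℕ} (a : Fin (n + 2) → A) :
    faceTuple 0 a = Fin.cons (a 0 * a 1) (fun j : Fin n => a j.succ.succ) := by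
  funext j
  cases j using Fin.cases <;> simp [faceTuple]

theorem faceTuple_succ_castSucc {n : ℕ} (a : Fin (n + 3) → A) (i : Fin (n + 1)) :
    faceTuple i.succ.castSucc a = Fin.cons (a 0) (faceTuple i.castSucc (Fin.tail a)) := by
  have := i.is_lt
  funext j
  cases j using Fin.cases
  · simp [faceTuple]; omega
  · simp [faceTuple, Fin.tail]; grind

theorem sum_neg_one_pow_mul_prod_faceTuple {e d : A → k}
    (hd : ∀ a b, d (a * b) = e a * d b + d a * e b) {n : ℕ} (a : Fin (n + 2) → A) :
    ∑ i : Fin (n + 1), (-1) ^ (i : ℕ) * ∏ j, d (faceTuple i.castSucc a j) =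
      replacedProd e d a 0 - (-1) ^ (n + 1) * replacedProd e d a (Fin.last _) := by
  let F : ℕ → k := fun i => if h : i < n + 2 then replacedProd e d a ⟨i, h⟩ else 0
  have h := sum_neg_one_pow_mul_add_succ F (n + 1)
  rw [Finset.sum_range] at h
  have h0 : F 0 = replacedProd e d a 0 := by simp [F]
  have h1 : F (n + 1) = replacedProd e d a (Fin.last _) := by simp [F, Fin.last]
  rw [← h0, ← h1, ← h]
  refine Finset.sum_congr rfl fun i _ => ?_
  have := i.is_lt
  rw [prod_faceTuple_castSucc hd]
  simp only [F, dif_pos (show (i : ℕ) < n + 2 by omega), dif_pos (show (i : ℕ) + 1 < n + 2 by omega)]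
  rfl

end Faces

/-! ### Explicit cocycles and cycles. -/

section Cocycles

variable {k A : Type u} [Field k] [Ring A] [Algebra k A]

/-- The functional `a_0 ⊗ ⋯ ⊗ a_n ↦ ∏ i, L i (a_i)`. -/
noncomputable def prodFunctional {n : ℕ} (L : Fin n → A →ₗ[k] k) : (⨂[k] _ : Fin n, A) →ₗ[k] k :=
  PiTensorProduct.lift ((MultilinearMap.mkPiAlgebra k (Fin n) k).compLinearMap L)

@[simp]
theorem prodFunctional_tprod {n : ℕ} (L : Fin n → A →ₗ[k] k) (a : Fin n → A) :
    prodFunctional L (PiTensorProduct.tprod k a) = ∏ i, L i (a i) := by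
  simp [prodFunctional]

theorem apply_differential_tprod {n : ℕ} (φ : (⨂[k] _ : Fin (n + 1), A) →ₗ[k] k)
    (a : Fin (n + 2) → A) :
    φ (differential k A n (PiTensorProduct.tprod k a)) =
      ∑ i : Fin (n + 2), (-1) ^ (i : ℕ) * φ (PiTensorProduct.tprod k (faceTuple i a)) := by
  simp [differential, LinearMap.sum_apply, face_tprod]

/-- In even degrees `d ⊗ ⋯ ⊗ d` is a cocycle for every derivation `d`. -/
theorem prodFunctional_const_comp_differential {e d : A →ₗ[k] k}
    (hd : ∀ a b, d (a * b) = e a * d b + d a * e b) {n : ℕ} (hn : Even n) :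
    prodFunctional (fun _ : Fin (n + 1) => d) ∘ₗ differential k A n = 0 := by
  refine PiTensorProduct.ext (MultilinearMap.ext fun a => ?_)
  simp only [LinearMap.compMultilinearMap_apply, LinearMap.comp_apply, apply_differential_tprod,
    prodFunctional_tprod, LinearMap.zero_apply]
  rw [Fin.sum_univ_castSucc]
  simp only [Fin.val_castSucc]
  -- By Leibniz the cyclic face gives the same two end terms that survive telescoping; its sign is
  -- `-1` as `n` is even.
  rw [sum_neg_one_pow_mul_prod_faceTuple hd, faceTuple_last, Fin.prod_univ_succ]
  simp only [Fin.cons_zero, Fin.cons_succ, hd, replacedProd, Fin.val_last, pow_succ, hn.neg_one_pow,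
    Fin.succAbove_zero, Fin.succAbove_last]
  rw [Fin.prod_univ_castSucc, Fin.prod_univ_succ (fun l : Fin (n + 1) => d (a l.castSucc))]
  simp only [Fin.succ_last, Fin.succ_castSucc, Fin.castSucc_zero]
  ring

/-- In positive degrees `e ⊗ d ⊗ ⋯ ⊗ d` is a cocycle for every derivation `d` over the
augmentation `e`. -/
theorem prodFunctional_cons_comp_differential {e d : A →ₗ[k] k}
    (he : ∀ a b, e (a * b) = e a * e b)
    (hd : ∀ a b, d (a * b) = e a * d b + d a * e b) (n : ℕ) :
    prodFunctional (Fin.cons e fun _ : Fin (n + 1) => d) ∘ₗ differential k A (n + 1) = 0 := by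
  refine PiTensorProduct.ext (MultilinearMap.ext fun a => ?_)
  simp only [LinearMap.compMultilinearMap_apply, LinearMap.comp_apply, apply_differential_tprod,
    prodFunctional_tprod, LinearMap.zero_apply]
  rw [Fin.sum_univ_castSucc, Fin.sum_univ_succ]
  have key := sum_neg_one_pow_mul_prod_faceTuple hd (Fin.tail a)
  have hmid : ∀ i : Fin (n + 1), ∏ j, (Fin.cons e (fun _ => d) : Fin (n + 2) → A →ₗ[k] k) j
      (faceTuple i.succ.castSucc a j) =
        e (a 0) * ∏ j, d (faceTuple i.castSucc (Fin.tail a) j) := by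
    intro i
    rw [faceTuple_succ_castSucc, Fin.prod_univ_succ]
    simp
  have hsum : ∑ i : Fin (n + 1), (-1 : k) ^ (i.succ.castSucc : ℕ) *
      ∏ j, (Fin.cons e (fun _ => d) : Fin (n + 2) → A →ₗ[k] k) j
        (faceTuple i.succ.castSucc a j) =
      -(e (a 0)) * (replacedProd e d (Fin.tail a) 0 -
        (-1) ^ (n + 1) * replacedProd e d (Fin.tail a) (Fin.last _)) := by
    rw [← key, Finset.mul_sum]
    refine Finset.sum_congr rfl fun i _ => ?_
    rw [hmid, Fin.val_castSucc, Fin.val_succ]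
    ring
  -- Faces `0` and last, by multiplicativity of `e`, each cancel one end of the telescoped sum,
  -- whatever the parity.
  rw [hsum, faceTuple_last, Fin.castSucc_zero, faceTuple_zero, Fin.prod_univ_succ,
    Fin.prod_univ_succ (n := n + 1)]
  simp only [Fin.cons_zero, Fin.cons_succ, he, replacedProd, Fin.val_last, Fin.tail, Fin.val_zero,
    Fin.succAbove_zero, Fin.succAbove_last, Fin.succ_last, Fin.succ_zero_eq_one, Fin.succ_castSucc]
  ring

/-- Every face has an entry `x * x`. -/
theorem differential_const_eq_zero {x : A} (hx : x * x = 0) (n : ℕ) :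
    differential k A n (PiTensorProduct.tprod k fun _ => x) = 0 := by
  rw [differential, LinearMap.sum_apply]
  refine Finset.sum_eq_zero fun i _ => ?_
  rw [LinearMap.smul_apply, face_tprod]
  have : ∃ j, faceTuple i (fun _ => x) j = 0 := by
    cases i using Fin.lastCases with
    | last => exact ⟨0, by rw [faceTuple_last]; exact hx⟩
    | cast i =>
      refine ⟨i, ?_⟩
      have := i.is_lt
      simp [faceTuple, hx]
      omega
  obtain ⟨j, hj⟩ := this
  rw [MultilinearMap.map_coord_zero _ j hj, smul_zero]

/-- Only the faces absorbing `1` survive; both equal `x ⊗ ⋯ ⊗ x`, with signs `1` and `(-1)^(n+1) =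
-1`. -/
theorem differential_one_cons_eq_zero {x : A} (hx : x * x = 0) {n : ℕ} (hn : Even n) :
    differential k A n (PiTensorProduct.tprod k (Fin.cons 1 fun _ => x)) = 0 := by
  rw [differential, LinearMap.sum_apply, Fin.sum_univ_castSucc, Fin.sum_univ_succ,
    Finset.sum_eq_zero]
  · simp only [LinearMap.smul_apply, face_tprod, Fin.castSucc_zero, faceTuple_zero,
      faceTuple_last, Fin.val_last, pow_succ, hn.neg_one_pow, Fin.val_zero, pow_zero]
    have h1 : (1 : Fin (n + 2)) = Fin.succ 0 := rfl
    have h2 : Fin.last (n + 1) = Fin.succ (Fin.last n) := rfl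
    have h3 : ∀ j : Fin n, j.succ.castSucc = j.castSucc.succ := fun j => rfl
    simp only [h1, h2, h3, Fin.cons_zero, Fin.cons_succ, one_mul, mul_one, one_smul]
    simp
  · intro i _
    rw [LinearMap.smul_apply, face_tprod]
    have : faceTuple i.succ.castSucc (Fin.cons (1 : A) fun _ => x) i.succ = 0 := by
      have := i.is_lt
      simp [faceTuple, hx]
    rw [MultilinearMap.map_coord_zero _ _ this, smul_zero]

/-- An algebra with elements `x i` of square zero and derivations dual to them over augmentations
has large Hochschild homology in every degree. -/
theorem le_hh_of_algHom_dualNumber {m : ℕ} (x : Fin m → A) (hx : ∀ i, x i * x i = 0)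
    (f : Fin m → A →ₐ[k] k[ε])
    (hf : ∀ i j, f i (x j) = if j = i then DualNumber.eps else 0) (n : ℕ) :
    (m : Cardinal.{u}) ≤ hh k A n := by
  let e : Fin m → A →ₗ[k] k := fun i =>
    (TrivSqZeroExt.fstHom k k k).toLinearMap ∘ₗ (f i).toLinearMap
  let d : Fin m → A →ₗ[k] k := fun i => TrivSqZeroExt.sndHom k k ∘ₗ (f i).toLinearMap
  have he : ∀ i a b, e i (a * b) = e i a * e i b := fun i a b => by simp [e]
  have hd : ∀ i a b, d i (a * b) = e i a * d i b + d i a * e i b := fun i a b => by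
    simp [e, d, mul_comm]
  have he1 : ∀ i, e i 1 = 1 := fun i => by simp [e]
  have hdx : ∀ i j, d i (x j) = if i = j then 1 else 0 := fun i j => by
    rcases eq_or_ne i j with rfl | h
    · simp [d, hf]
    · simp [d, hf, h, h.symm]
  rcases Nat.even_or_odd n with hn | hn
  · refine le_hh_of_pairing k A n m (fun i => PiTensorProduct.tprod k fun _ => x i)
      (fun i => prodFunctional fun _ => d i) ?_
      (fun i => prodFunctional_const_comp_differential (hd i) hn) ?_
    · intro i l
      cases n with
      | zero =>
        rw [(hochschildComplex k A).shape _ _ (by simp)]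
        rfl
      | succ n => exact hochschildComplex_d_apply_eq_zero k A _ (differential_const_eq_zero (hx i) n) l
    · intro i j
      simp [hdx]
  · obtain ⟨l, hl⟩ := hn
    obtain rfl : n = (2 * l) + 1 := hl
    refine le_hh_of_pairing k A _ m (fun i => PiTensorProduct.tprod k (Fin.cons 1 fun _ => x i))
      (fun i => prodFunctional (Fin.cons (e i) fun _ => d i)) ?_
      (fun i => prodFunctional_cons_comp_differential (he i) (hd i) _) ?_
    · exact fun i l' => hochschildComplex_d_apply_eq_zero k A _
        (differential_one_cons_eq_zero (hx i) (even_two_mul l)) l'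
    · intro i j
      rw [prodFunctional_tprod, Fin.prod_univ_succ]
      simp [hdx, he1]

theorem hhDim_eq_top_of_forall_ne_zero (h : ∀ n, hh k A n ≠ 0) : hhDim k A = ⊤ := by
  refine sInf_eq_top.2 ?_
  rintro _ ⟨n, -, hn⟩
  exact absurd (hn (n + 1) n.lt_succ_self) (h _)

end Cocycles

end Hochschild

theorem mainTheorem3 {k : Type*} [Field k] (q : k) :
    Hochschild.hhDim k (Hochschild.Aq q) = ⊤ ∧
      Hochschild.globalDim (Hochschild.Aq q) = ⊤ ∧
      ∀ n : ℕ, 2 ≤ Hochschild.hh k (Hochschild.Aq q) n := by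
  choose f hf using Hochschild.exists_algHom_dualNumber q
  have hgen : ∀ i, Hochschild.gen q i * Hochschild.gen q i = 0 :=
    Fin.forall_fin_two.2 ⟨Hochschild.gen_zero_mul_gen_zero q, Hochschild.gen_one_mul_gen_one q⟩
  have h : ∀ n : ℕ, 2 ≤ Hochschild.hh k (Hochschild.Aq q) n := fun n => by
    exact_mod_cast Hochschild.le_hh_of_algHom_dualNumber (Hochschild.gen q) hgen f hf n
  refine ⟨Hochschild.hhDim_eq_top_of_forall_ne_zero fun n h0 => ?_, Hochschild.globalDim_Aq q, h⟩
  have h2 := h n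
  rw [h0] at h2
  exact two_ne_zero (le_antisymm h2 zero_le)
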